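/- Write $e(y)=e^{2\pi i y}$ and $\|a\|_{\ell^2}=(\sum_{n\in\mathbb Z}|a_n|^2)^{1/2}$. For $\epsilon>0$, integers $N\ge1$, $l\ge 0$ and a dyadic integer $1\le Q\le N$ (a power of 2), let $$S_{Q,l}=\bigcup_{Q\le q<2Q}\ \bigcup_{a\in\mathcal A(q)}\ \bigcup_{0\le b\le q-1}\Big[\tfrac bq-\tfrac{N^\epsilon}{2^lq},\tfrac bq+\tfrac{N^\epsilon}{2^lq}\Big]\times\Big[\tfrac aq-\tfrac1{2^lqN},\tfrac aq+\tfrac1{2^lqN}\Big],$$ where $\mathcal A(1)=\{0\}$ and $\mathcal A(q)=\{1\le a\le q-1:\gcd(a,q)=1\}$ for $q\ge2$, and let $\tilde 1_{S_{Q,l}}$ be the $1\times1$-periodic extension of the indicator function of $S_{Q,l}$ (the indicator function of $S_{Q,l}+\mathbb Z^2$). Let $M=M_N$ satisfy $1\le M_N\le N^{1/4}$ for all $N\ge1$. We say that the counting conjecture holds for $M$ if the following is true for every real-valued Schwartz function $w$ supported on $[-2,2]$: for every $\delta>0$ there is $\epsilon>0$ such that for every $C$ there is $C'$ (depending on $M,w,\delta,\epsilon,C$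 only) such that for all $N\ge1$, all dyadic $1\le Q\le N$, all $l\ge0$ with $2^l\le N/Q$, all $a\in\ell^2(\mathbb Z)$ with $\|a\|_{\ell^2}=1$, and all finite families $z_r=(x_r,t_r)\in[0,1]^2$, $1\le r\le R$, with $|x_r-x_{r'}|\ge 1/N$ for $r\ne r'$: if $$\Big|\sum_{n\in\mathbb Z}a_n\,w(n/N)\,e(nx_r+n^2t_r)\Big|\ge M_NN^{1/4}\quad(1\le r\le R)$$ and $$R^2\le C N^{\epsilon}\,\frac{2^{l/2}}{M_N^2}\sum_{r,r'=1}^R\tilde 1_{S_{Q,l}}(z_r-z_{r'}),$$ then $R\le C'N^{\delta}\,N/M_N^4$. **Proposition.** If the counting conjecture holds for $M$, then the level set estimate holds for all $\lambda\sim MN^{1/4}$. That is, for all $c_1,c_2>0$ and all $\epsilon>0$ there is $K$ (depending on $M,c_1,c_2,\epsilon$ only) such that $$\Big|\Big\{x\in[0,1]:\ \sup_{t\in\mathbb R}\Big|\sum_{n=1}^Na_n\,e(nx+n^2t)\Big|\ge\lambda\Big\}\Big|\le K\,N^{\epsilon}\,\frac{N}{\lambda^4}$$ for all $N\ge1$,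 all $\lambda$ with $c_1M_NN^{1/4}\le\lambda\le c_2M_NN^{1/4}$, and all $a$ with $\|a\|_{\ell^2}=1$. -/

import Mathlib

open Set MeasureTheory

noncomputable section

namespace PeriodicSchrodinger

/-- The character `e(y) = exp(2πiy)`. -/
def e (y : ℝ) : ℂ := Complex.exp (2 * Real.pi * Complex.I * y)

/-- `‖a‖_{ℓ²(ℤ)} = 1`. -/
def L2Normalized (a : ℤ → ℂ) : Prop := HasSum (fun n : ℤ => ‖a n‖ ^ 2) 1

/-- The sharply truncated sum `∑_{n=1}^N a_n e(nx + n²t)`. -/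
def schrodingerSum (N : ℕ) (a : ℤ → ℂ) (x t : ℝ) : ℂ :=
  ∑ n ∈ Finset.Icc (1 : ℤ) N, a n * e (n * x + (n : ℝ) ^ 2 * t)

/-- The smoothly truncated sum `∑_{n ∈ ℤ} a_n w(n/N) e(nx + n²t)`. For `w` supported on
`[-2,2]` and `N ≥ 1` only finitely many terms are nonzero. -/
def weightedSum (w : SchwartzMap ℝ ℝ) (N : ℕ) (a : ℤ → ℂ) (x t : ℝ) : ℂ :=
  ∑' n : ℤ, a n * (w ((n : ℝ) / N) : ℂ) * e (n * x + (n : ℝ) ^ 2 * t)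

/-- The admissible numerators: `A(1) = {0}` and, for `q ≥ 2`,
`A(q) = {1 ≤ a ≤ q - 1 : gcd(a,q) = 1}`. -/
def numerators (q : ℕ) : Set ℕ :=
  {a | (q = 1 ∧ a = 0) ∨ (2 ≤ q ∧ 1 ≤ a ∧ a + 1 ≤ q ∧ Nat.gcd a q = 1)}

/-- The set `S_{Q,l}`: the union, over `Q ≤ q < 2Q`, `a ∈ A(q)` and `0 ≤ b ≤ q - 1`, of the boxes
`[b/q - N^ε/(2^l q), b/q + N^ε/(2^l q)] × [a/q - 1/(2^l q N), a/q + 1/(2^l q N)]`. -/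
def S (N : ℕ) (ε : ℝ) (Q l : ℕ) : Set (ℝ × ℝ) :=
  ⋃ q ∈ Finset.Ico Q (2 * Q), ⋃ a ∈ numerators q, ⋃ b ∈ Finset.range q,
    Icc ((b : ℝ) / q - (N : ℝ) ^ ε / (2 ^ l * q)) ((b : ℝ) / q + (N : ℝ) ^ ε / (2 ^ l * q)) ×ˢ
    Icc ((a : ℝ) / q - 1 / (2 ^ l * q * N)) ((a : ℝ) / q + 1 / (2 ^ l * q * N))

/-- The smallest `1 × 1`-periodic set containing `A`; its indicator function is the
`1 × 1`-periodic extension of the indicator function of `A`. -/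
def periodize (A : Set (ℝ × ℝ)) : Set (ℝ × ℝ) :=
  {p | ∃ m n : ℤ, (p.1 - m, p.2 - n) ∈ A}

/-- `∑_{r,r'} 1̃_{S_{Q,l}}(z_r - z_{r'})`. -/
def pairCount (N : ℕ) (ε : ℝ) (Q l : ℕ) {R : ℕ} (z : Fin R → ℝ × ℝ) : ℝ :=
  ∑ r : Fin R, ∑ s : Fin R,
    (periodize (S N ε Q l)).indicator (fun _ => (1 : ℝ)) (z r - z s)

/-- The counting conjecture for the scale function `M = M_N`, uniformly in `Q` and `l`, for
arbitrary weights `w`. An implication between two inequalities with losses `N^ε` for all small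
`ε` means: for every loss `N^δ` allowed in the conclusion there is a positive `ε` such that the
hypothesis with loss `C N^ε` (the same `ε` as in `S_{Q,l}`) and an arbitrary constant `C`
implies the conclusion with loss `C' N^δ`, where `C'` depends only on `w, δ, ε, C` and on the
function `M`. -/
def CountingConjecture (M : ℕ → ℝ) : Prop :=
  ∀ w : SchwartzMap ℝ ℝ, Function.support w ⊆ Icc (-2 : ℝ) 2 →
  ∀ δ : ℝ, 0 < δ → ∃ ε : ℝ, 0 < ε ∧ ∀ C : ℝ, ∃ C' : ℝ,
  ∀ N : ℕ, 1 ≤ N →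
  ∀ Q l : ℕ, (∃ k : ℕ, Q = 2 ^ k) → Q ≤ N → (2 : ℝ) ^ l ≤ (N : ℝ) / Q →
  ∀ a : ℤ → ℂ, L2Normalized a →
  ∀ (R : ℕ) (z : Fin R → ℝ × ℝ),
    (∀ r, z r ∈ Icc (0 : ℝ) 1 ×ˢ Icc (0 : ℝ) 1) →
    (∀ r s, r ≠ s → 1 / (N : ℝ) ≤ |(z r).1 - (z s).1|) →
    (∀ r, M N * (N : ℝ) ^ (1 / 4 : ℝ) ≤ ‖weightedSum w N a (z r).1 (z r).2‖) →
    (R : ℝ) ^ 2 ≤ C * (N : ℝ) ^ ε * ((2 : ℝ) ^ ((l : ℝ) / 2) / M N ^ 2 * pairCount N ε Q l z) →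
    (R : ℝ) ≤ C' * (N : ℝ) ^ δ * ((N : ℝ) / M N ^ 4)

/-- The level set `{x ∈ [0,1] : sup_t |∑_{n=1}^N a_n e(nx + n²t)| ≥ lam}`. -/
def levelSet (N : ℕ) (a : ℤ → ℂ) (lam : ℝ) : Set ℝ :=
  {x | x ∈ Icc (0 : ℝ) 1 ∧ lam ≤ ⨆ t : ℝ, ‖schrodingerSum N a x t‖}

end PeriodicSchrodinger

end

namespace PeriodicSchrodinger

/-! A maximal `1/N`-separated family of `R` points in the level set controls its measure by `2R/N`.
Since `lam ∼ M N^{1/4}`, the target `N/lam^4` is comparable to `1/M^4`, so it suffices that `R ≲ N^ε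
N/M^4`. This is the conclusion of the conjecture; the work is to find `Q, l` for which its
hypothesis holds.

Duality (`large_values_le_gaussianKernel`) bounds `R² lam²` by the sum of `|K(z_r - z_s)|` over all
pairs, where `K` is a Weyl sum with Gaussian weight, so that Poisson summation is exact. Dirichlet
approximation, Poisson summation modulo `q` and square-root cancellation in Gauss sums give `|K| ≲
2^{l/2} N^{1/2}` on some `S_{Q,l}`, and a negligible bound otherwise
(`exists_norm_gaussianKernel_le`). Only `O(log² N)` pairs `(Q, l)` occur, so one of them carries the
sum up to `N^ε`. Dividing by `M² N^{1/2}` gives the hypothesis for large `N`; for bounded `N` the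
trivial measure bound `1` suffices. -/

/-! ### The character and quadratic Gauss sums -/

lemma e_add (x y : ℝ) : e (x + y) = e x * e y := by
  simp only [e, ← Complex.exp_add]
  push_cast
  ring_nf

lemma norm_e (y : ℝ) : ‖e y‖ = 1 := by
  rw [e, show 2 * (Real.pi : ℂ) * Complex.I * (y : ℂ) = ((2 * Real.pi * y : ℝ) : ℂ) * Complex.I by
    push_cast; ring]
  exact Complex.norm_exp_ofReal_mul_I _

lemma e_intCast (n : ℤ) : e n = 1 := by
  rw [e, ← Complex.exp_int_mul_two_pi_mul_I n]
  push_cast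
  ring_nf

lemma e_add_intCast (y : ℝ) (n : ℤ) : e (y + n) = e y := by
  rw [e_add, e_intCast, mul_one]

lemma conj_e (y : ℝ) : (starRingEnd ℂ) (e y) = e (-y) := by
  rw [e, e, ← Complex.exp_conj]
  simp only [map_mul, Complex.conj_I, Complex.conj_ofReal, map_ofNat]
  push_cast
  ring_nf

lemma e_div_eq_stdAddChar (q : ℕ) [NeZero q] (j : ℤ) :
    e ((j : ℝ) / q) = ZMod.stdAddChar (j : ZMod q) := by
  rw [ZMod.stdAddChar_coe, e]
  push_cast
  ring_nf

/-- The square-root bound for complete quadratic Gauss sums. -/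
lemma norm_gaussSum_sq_le (q : ℕ) [NeZero q] (a k : ZMod q) (ha : IsUnit a) :
    ‖∑ j : ZMod q, (ZMod.stdAddChar (a * j ^ 2 + k * j) : ℂ)‖ ^ 2 ≤ 2 * q := by
  set G := ∑ j : ZMod q, (ZMod.stdAddChar (a * j ^ 2 + k * j) : ℂ) with hG
  have h1 : G * (starRingEnd ℂ) G = ∑ h : ZMod q, (ZMod.stdAddChar (a * h ^ 2 + k * h) : ℂ) *
      if 2 * a * h = 0 then (Fintype.card (ZMod q) : ℂ) else 0 := by
    rw [hG, map_sum, Finset.sum_mul_sum, Finset.sum_comm]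
    calc _ = ∑ y : ZMod q, ∑ h : ZMod q, (ZMod.stdAddChar (a * h ^ 2 + k * h) : ℂ) *
          ZMod.stdAddChar (y * (2 * a * h)) := by
          refine Finset.sum_congr rfl fun y _ => ?_
          -- Weyl differencing: with `j = h + y` the phase difference is linear in `y`, so the
          -- `y`-sum vanishes unless `2ah = 0`.
          rw [← Equiv.sum_comp (Equiv.addRight y)]
          refine Finset.sum_congr rfl fun h _ => ?_
          rw [← AddChar.map_neg_eq_conj, ← AddChar.map_add_eq_mul, ← AddChar.map_add_eq_mul,
            Equiv.coe_addRight]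
          congr 1
          ring
      _ = _ := by
          rw [Finset.sum_comm]
          refine Finset.sum_congr rfl fun h _ => ?_
          rw [← Finset.mul_sum, AddChar.sum_mulShift _ (ZMod.isPrimitive_stdAddChar q)]
          simp
  have h2 : ‖G‖ ^ 2 = ‖G * (starRingEnd ℂ) G‖ := by
    rw [norm_mul, RCLike.norm_conj, sq]
  rw [h2, h1]
  refine (norm_sum_le _ _).trans ?_
  calc _ ≤ ∑ h : ZMod q, if 2 • h = 0 then (q : ℝ) else 0 := by
        refine Finset.sum_le_sum fun h _ => ?_
        rw [norm_mul, AddChar.norm_apply, one_mul]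
        have : 2 * a * h = 0 ↔ 2 • h = 0 := by
          rw [show 2 * a * h = a * (2 • h) by rw [nsmul_eq_mul]; push_cast; ring]
          exact ha.mul_right_eq_zero
        simp only [this]
        split_ifs <;> simp [ZMod.card]
    _ = (Finset.card {h : ZMod q | 2 • h = 0} : ℝ) * q := by
        rw [← Finset.sum_filter, Finset.sum_const, nsmul_eq_mul]
    _ ≤ _ := by
        gcongr
        -- At most two solutions of `2h = 0` in a cyclic group: the source of the factor 2.
        exact_mod_cast IsAddCyclic.card_nsmul_eq_zero_le (α := ZMod q) two_pos

/-! ### Gaussian sums and Poisson summation -/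

lemma summable_gaussian {s : ℝ} (hs : 0 < s) (y : ℝ) :
    Summable fun k : ℤ => Real.exp (-Real.pi * ((k : ℝ) - y) ^ 2 * s) := by
  simpa [sub_eq_add_neg] using (HurwitzZeta.hasSum_int_evenKernel (-y) hs).summable

/-- Recentring at the integer nearest to `y` leaves `|k + round y - y| ≥ |k|/2`. The threshold
`1/16` is half of the lower bound `1/8` available for `Re(1/A)` later. -/
lemma exists_tsum_gaussian_le : ∃ C : ℝ, 0 < C ∧ ∀ s : ℝ, 1 / 16 ≤ s → ∀ y : ℝ,
    ∑' k : ℤ, Real.exp (-Real.pi * ((k : ℝ) - y) ^ 2 * s) ≤ C := by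
  have hsum : Summable fun k : ℤ => Real.exp (-Real.pi * (k : ℝ) ^ 2 * (1 / 64)) := by
    simpa using summable_gaussian (s := 1 / 64) (by norm_num) 0
  refine ⟨_, hsum.tsum_pos (fun _ => (Real.exp_pos _).le) 0 (Real.exp_pos _), fun s hs y => ?_⟩
  have hs0 : 0 < s := by linarith
  rw [← (Equiv.addRight (round y)).tsum_eq]
  refine Summable.tsum_le_tsum (fun k => ?_)
    ((Equiv.addRight (round y)).summable_iff.mpr (summable_gaussian hs0 y)) hsum
  rw [Real.exp_le_exp, Equiv.coe_addRight]
  have hf := abs_sub_round y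
  have key : (k : ℝ) ^ 2 / 4 ≤ ((k + round y : ℤ) - y) ^ 2 := by
    push_cast
    rw [show (k : ℝ) ^ 2 / 4 = (k / 2) ^ 2 by ring]
    rw [abs_le] at hf
    rw [sq_le_sq]
    rcases lt_trichotomy k 0 with h | h | h
    · have : (k : ℝ) ≤ -1 := by exact_mod_cast (by omega : k ≤ -1)
      rw [abs_of_neg (by linarith), abs_of_neg (by linarith)]
      linarith
    · subst h
      simp
    · have : (1 : ℝ) ≤ k := by exact_mod_cast h
      rw [abs_of_pos (by linarith), abs_of_pos (by linarith)]
      linarith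
  have h3 : (k : ℝ) ^ 2 / 4 * (1 / 16) ≤ ((k + round y : ℤ) - y) ^ 2 * s := by gcongr
  nlinarith [Real.pi_pos]

/-- The quadratic exponential sum with a Gaussian weight at scale `N`. -/
noncomputable def gaussianKernel (N : ℕ) (x t : ℝ) : ℂ :=
  ∑' n : ℤ, (Real.exp (-Real.pi * (n : ℝ) ^ 2 * (1 / (N : ℝ) ^ 2)) : ℂ) *
    e (n * x + (n : ℝ) ^ 2 * t)

lemma summable_gaussianKernel {N : ℕ} (hN : 1 ≤ N) (x t : ℝ) :
    Summable fun n : ℤ => (Real.exp (-Real.pi * (n : ℝ) ^ 2 * (1 / (N : ℝ) ^ 2)) : ℂ) *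
      e (n * x + (n : ℝ) ^ 2 * t) := by
  have hN' : (0 : ℝ) < N := by exact_mod_cast hN
  have h := summable_gaussian (s := 1 / (N : ℝ) ^ 2) (by positivity) 0
  refine Summable.of_norm ?_
  simpa only [norm_mul, norm_e, mul_one, Complex.norm_real, Real.norm_eq_abs, Real.abs_exp,
    sub_zero] using h

lemma norm_gaussSum_le (q : ℕ) [NeZero q] (a k : ℤ) (ha : IsCoprime a q) :
    ‖∑ j : Fin q, e (((a * (j : ℕ) ^ 2 + k * (j : ℕ) : ℤ) : ℝ) / q)‖ ≤ √(2 * q) := by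
  apply Real.le_sqrt_of_sq_le
  have hbij : Function.Bijective fun j : Fin q => ((j : ℕ) : ZMod q) := by
    rw [Fintype.bijective_iff_injective_and_card]
    refine ⟨fun i j hij => ?_, by simp [ZMod.card]⟩
    have := (ZMod.natCast_eq_natCast_iff' _ _ _).mp hij
    rwa [Nat.mod_eq_of_lt i.2, Nat.mod_eq_of_lt j.2, ← Fin.ext_iff] at this
  have h := norm_gaussSum_sq_le q (a : ZMod q) (k : ZMod q)
    ((ZMod.coe_int_isUnit_iff_isCoprime a q).mpr ha.symm)
  convert h using 3
  refine Fintype.sum_bijective _ hbij _ _ fun j => ?_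
  rw [e_div_eq_stdAddChar]
  push_cast
  rfl

/-- Poisson summation along residue classes modulo `q`. -/
lemma gaussianKernel_eq {N q : ℕ} (hN : 1 ≤ N) [NeZero q] (a : ℤ) (x β : ℝ) (A : ℂ)
    (hA : A = (q : ℂ) ^ 2 * (1 / (N : ℂ) ^ 2 - 2 * Complex.I * β)) (hA0 : 0 < A.re)
    (hsum : Summable fun k : ℤ => Complex.exp (-Real.pi / A * ((k : ℂ) - q * x) ^ 2)) :
    gaussianKernel N x ((a : ℝ) / q + β) = 1 / A ^ (1 / 2 : ℂ) *
      ∑' k : ℤ, Complex.exp (-Real.pi / A * ((k : ℂ) - q * x) ^ 2) *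
        ∑ j : Fin q, e (((a * (j : ℕ) ^ 2 + k * (j : ℕ) : ℤ) : ℝ) / q) := by
  have hq : (q : ℂ) ≠ 0 := by exact_mod_cast NeZero.ne q
  have hN0 : (N : ℂ) ≠ 0 := by exact_mod_cast (by omega : N ≠ 0)
  set τ : ℂ := 1 / (N : ℂ) ^ 2 - 2 * Complex.I * β with hτ
  have hτ0 : τ ≠ 0 := by
    rintro h
    rw [hA, h] at hA0
    simp at hA0
  have hF := summable_gaussianKernel hN x ((a : ℝ) / q + β)
  have hF' := ((Int.divModEquiv q).trans (Equiv.prodComm _ _)).symm.summable_iff.mpr hF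
  rw [gaussianKernel, ← ((Int.divModEquiv q).trans (Equiv.prodComm _ _)).symm.tsum_eq]
  refine (Summable.tsum_prod hF').trans ?_
  rw [tsum_fintype]
  have hinner : ∀ j : Fin q, ∑' m : ℤ,
      (Real.exp (-Real.pi * ((m * q + (j : ℕ) : ℤ) : ℝ) ^ 2 * (1 / (N : ℝ) ^ 2)) : ℂ) *
        e ((m * q + (j : ℕ) : ℤ) * x + ((m * q + (j : ℕ) : ℤ) : ℝ) ^ 2 * ((a : ℝ) / q + β)) =
      1 / A ^ (1 / 2 : ℂ) * ∑' k : ℤ, Complex.exp (-Real.pi / A * ((k : ℂ) - q * x) ^ 2) *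
        e (((a * (j : ℕ) ^ 2 + k * (j : ℕ) : ℤ) : ℝ) / q) := by
    intro j
    have h1 : ∀ m : ℤ,
        (Real.exp (-Real.pi * ((m * q + (j : ℕ) : ℤ) : ℝ) ^ 2 * (1 / (N : ℝ) ^ 2)) : ℂ) *
          e ((m * q + (j : ℕ) : ℤ) * x + ((m * q + (j : ℕ) : ℤ) : ℝ) ^ 2 * ((a : ℝ) / q + β)) =
        Complex.exp (-Real.pi * (j : ℕ) ^ 2 * τ + 2 * Real.pi * Complex.I * ((j : ℕ) * x)
          + 2 * Real.pi * Complex.I * (a * (j : ℕ) ^ 2 / q)) *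
        Complex.exp (-Real.pi * A * m ^ 2 +
          2 * Real.pi * (-q * (j : ℕ) * τ + Complex.I * q * x) * m) := by
      intro m
      rw [e, Complex.ofReal_exp, ← Complex.exp_add, ← Complex.exp_add,
        Complex.exp_eq_exp_iff_exists_int]
      -- For `n = mq + j`, this integer is `a n²/q - a j²/q`.
      refine ⟨a * (m ^ 2 * q + 2 * m * (j : ℕ)), ?_⟩
      rw [hA, hτ]
      push_cast
      field_simp
      ring
    simp_rw [h1]
    rw [tsum_mul_left, Complex.tsum_exp_neg_quadratic hA0, mul_left_comm, ← tsum_mul_left]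
    congr 2
    ext k
    rw [e, ← Complex.exp_add, ← Complex.exp_add]
    congr 1
    rw [hA]
    push_cast
    field_simp
    ring_nf
    simp only [Complex.I_sq, Complex.I_pow_three, Complex.I_pow_four]
    ring
  calc _ = ∑ j : Fin q, 1 / A ^ (1 / 2 : ℂ) * ∑' k : ℤ,
        Complex.exp (-Real.pi / A * ((k : ℂ) - q * x) ^ 2) *
          e (((a * (j : ℕ) ^ 2 + k * (j : ℕ) : ℤ) : ℝ) / q) :=
        Finset.sum_congr rfl fun j _ => hinner j
    _ = _ := by
        rw [← Finset.mul_sum, ← Summable.tsum_finsetSum]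
        · simp_rw [Finset.mul_sum]
        · intro j _
          refine Summable.of_norm ?_
          simpa only [norm_mul, norm_e, mul_one] using hsum.norm

/-- The Gauss sum bound is uniform in the dual frequency `k`, so absolute values may be taken
termwise after Poisson summation. -/
lemma norm_gaussianKernel_le {N q : ℕ} (hN : 1 ≤ N) [NeZero q] (a : ℤ) (ha : IsCoprime a q)
    (x β : ℝ) (A : ℂ) (hA : A = (q : ℂ) ^ 2 * (1 / (N : ℂ) ^ 2 - 2 * Complex.I * β))
    (hA0 : 0 < A.re) :
    ‖gaussianKernel N x ((a : ℝ) / q + β)‖ ≤ √(2 * q / ‖A‖) *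
      ∑' k : ℤ, Real.exp (-Real.pi * ((k : ℝ) - q * x) ^ 2 * (1 / A).re) := by
  have hAne : A ≠ 0 := by
    rintro rfl
    simp at hA0
  have hs : 0 < (1 / A).re := by
    rw [one_div, Complex.inv_re]
    exact div_pos hA0 (Complex.normSq_pos.mpr hAne)
  have hnorm : ∀ k : ℤ, ‖Complex.exp (-Real.pi / A * ((k : ℂ) - q * x) ^ 2)‖ =
      Real.exp (-Real.pi * ((k : ℝ) - q * x) ^ 2 * (1 / A).re) := by
    intro k
    rw [Complex.norm_exp, show -(Real.pi : ℂ) / A * ((k : ℂ) - q * x) ^ 2 =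
      ((-Real.pi * ((k : ℝ) - q * x) ^ 2 : ℝ) : ℂ) * (1 / A) by push_cast; ring,
      Complex.re_ofReal_mul]
  have hsum := summable_gaussian hs (q * x)
  rw [gaussianKernel_eq hN a x β A hA hA0 (Summable.of_norm (by simpa only [hnorm] using hsum)),
    norm_mul]
  have h1 : ‖1 / A ^ (1 / 2 : ℂ)‖ = 1 / √‖A‖ := by
    rw [norm_div, norm_one, show (1 / 2 : ℂ) = ((1 / 2 : ℝ) : ℂ) by push_cast; rfl,
      Complex.norm_cpow_real, Real.sqrt_eq_rpow]
  have hle : ∀ k : ℤ, ‖Complex.exp (-Real.pi / A * ((k : ℂ) - q * x) ^ 2) *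
      ∑ j : Fin q, e (((a * (j : ℕ) ^ 2 + k * (j : ℕ) : ℤ) : ℝ) / q)‖ ≤
      √(2 * q) * Real.exp (-Real.pi * ((k : ℝ) - q * x) ^ 2 * (1 / A).re) := by
    intro k
    rw [norm_mul, hnorm, mul_comm]
    gcongr
    exact norm_gaussSum_le q a k ha
  have h2 := tsum_of_norm_bounded (hsum.mul_left (√(2 * q))).hasSum hle
  rw [tsum_mul_left] at h2
  rw [h1, Real.sqrt_div' _ (norm_nonneg _), div_mul_eq_mul_div, div_mul_eq_mul_div, one_mul]
  gcongr

/-! ### Major arcs and the sets `S_{Q,l}` -/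

/-- The dyadic scale of the distance `|β|` from a fraction with denominator `q ∼ Q`. -/
lemma exists_dyadic_scale {N Q q : ℕ} (hQ : 1 ≤ Q) (hQN : Q ≤ N) (hq : Q ≤ q) (hq2 : q < 2 * Q)
    {β : ℝ} (hβ : |β| ≤ 1 / (q * N)) :
    ∃ l : ℕ, (2 : ℝ) ^ l ≤ (N : ℝ) / Q ∧ |β| ≤ 1 / (2 ^ l * q * N) ∧
      ((N : ℝ) < 2 * 2 ^ l * q ∨ 1 < 2 * 2 ^ l * |β| * q * N) := by
  have hQ0 : (0 : ℝ) < Q := by exact_mod_cast hQ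
  have hN0 : (0 : ℝ) < N := by exact_mod_cast (by omega : 0 < N)
  have hq0 : (0 : ℝ) < q := by exact_mod_cast (by omega : 0 < q)
  have hqQ : (Q : ℝ) ≤ q := by exact_mod_cast hq
  -- If no `l` were the last admissible one, both bounds would pass from `l` to `l + 1` forever,
  -- contradicting `2^l ≤ N`.
  by_contra! hcon
  have hP : ∀ l : ℕ, (2 : ℝ) ^ l ≤ (N : ℝ) / Q ∧ |β| ≤ 1 / (2 ^ l * q * N) := by
    intro l
    induction l with
    | zero =>
      refine ⟨?_, by simpa using hβ⟩
      rw [pow_zero, le_div_iff₀ hQ0, one_mul]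
      exact_mod_cast hQN
    | succ l ih =>
      obtain ⟨h1, h2⟩ := hcon l ih.1 ih.2
      constructor
      · rw [le_div_iff₀ hQ0, pow_succ]
        have : (2 : ℝ) ^ l * 2 * Q ≤ 2 ^ l * 2 * q := by gcongr
        linarith
      · rw [le_div_iff₀ (by positivity), pow_succ]
        linarith
  have h3 := (hP N).1
  have h4 : (N : ℝ) < 2 ^ N := by exact_mod_cast Nat.lt_two_pow_self
  have h5 : (N : ℝ) / Q ≤ N := div_le_self hN0.le (by exact_mod_cast hQ)
  linarith

/-- Reducing `a` and `k` modulo `q` gives the centre of a box; the integer quotients are the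
periodic translations. -/
lemma mem_periodize_S {N Q q l : ℕ} {ε x β : ℝ} {a k : ℤ} (hq : Q ≤ q) (hq2 : q < 2 * Q)
    (ha : IsCoprime a q) (hβ : |β| ≤ 1 / (2 ^ l * q * N))
    (hk : |(k : ℝ) - q * x| ≤ (N : ℝ) ^ ε / 2 ^ l) :
    (x, (a : ℝ) / q + β) ∈ periodize (S N ε Q l) := by
  have hq1 : 0 < q := by omega
  have hq0 : (0 : ℝ) < q := by exact_mod_cast hq1
  have hqz : (0 : ℤ) < q := by exact_mod_cast hq1
  have hdiv : ∀ c : ℤ, (c : ℝ) / q - (c / q : ℤ) = ((c % q).toNat : ℝ) / q := by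
    intro c
    have h1 : (((c % q).toNat : ℤ) : ℝ) = ((c % q : ℤ) : ℝ) := by
      rw [Int.toNat_of_nonneg (Int.emod_nonneg _ hqz.ne')]
    have h2 : ((c % q : ℤ) : ℝ) = c - q * (c / q : ℤ) := by
      rw [Int.emod_def]
      push_cast
      ring
    rw [Int.cast_natCast] at h1
    rw [h1, h2]
    field_simp
  have hlt : ∀ c : ℤ, (c % q).toNat < q := by
    intro c
    have := Int.emod_lt_of_pos c hqz
    have := Int.emod_nonneg c hqz.ne'
    omega
  refine ⟨k / q, a / q, ?_⟩
  simp only [S, mem_iUnion]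
  refine ⟨q, Finset.mem_Ico.mpr ⟨hq, hq2⟩, (a % q).toNat, ?_, (k % q).toNat,
    Finset.mem_range.mpr (hlt k), ?_⟩
  · have hg : Nat.gcd (a % q).toNat q = 1 := by
      have h1 : IsCoprime (a % q) (q : ℤ) := by
        rw [Int.emod_def, sub_eq_add_neg, ← mul_neg]
        exact ha.add_mul_left_left _
      have h2 := Int.isCoprime_iff_gcd_eq_one.mp h1
      rw [← Int.toNat_of_nonneg (Int.emod_nonneg a hqz.ne'), Int.gcd_natCast_natCast] at h2
      exact h2
    have := hlt a
    rcases Nat.eq_or_lt_of_le hq1 with h | h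
    · left
      omega
    · right
      refine ⟨h, ?_, by omega, hg⟩
      by_contra h0
      rw [show (a % q).toNat = 0 by omega, Nat.gcd_zero_left] at hg
      omega
  · rw [abs_le] at hβ
    have hx : x - (k / q : ℤ) = ((k % q).toNat : ℝ) / q - (k - q * x) / q := by
      rw [← hdiv]
      field_simp
      ring
    have ht : (a : ℝ) / q + β - (a / q : ℤ) = ((a % q).toNat : ℝ) / q + β := by
      rw [← hdiv]
      ring
    have hd : |((k : ℝ) - q * x) / q| ≤ (N : ℝ) ^ ε / (2 ^ l * q) := by
      rw [abs_div, abs_of_pos hq0, ← div_div]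
      gcongr
    rw [abs_le] at hd
    refine ⟨?_, ?_⟩
    · simp only [hx, mem_Icc]
      constructor <;> linarith
    · simp only [ht, mem_Icc]
      constructor <;> linarith

/-- Major-arc bound for the Gaussian kernel: up to a rapidly decaying error it is
`O(2^{l/2} N^{1/2})` on one of the sets `S_{Q,l}`. -/
lemma exists_norm_gaussianKernel_le : ∃ C : ℝ, 0 < C ∧ ∀ N : ℕ, 1 ≤ N → ∀ ε x t : ℝ,
    ∃ k l : ℕ, 2 ^ k ≤ N ∧ (2 : ℝ) ^ l ≤ (N : ℝ) / (2 ^ k : ℕ) ∧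
      ‖gaussianKernel N x t‖ ≤ C * √(2 ^ l * N) *
        ((periodize (S N ε (2 ^ k) l)).indicator (fun _ => (1 : ℝ)) (x, t) +
          Real.exp (-Real.pi * ((N : ℝ) ^ ε) ^ 2 / 16)) := by
  obtain ⟨C₀, hC₀, hC⟩ := exists_tsum_gaussian_le
  refine ⟨2 * C₀, by positivity, fun N hN ε x t => ?_⟩
  obtain ⟨r, hr, hrN⟩ := Real.exists_rat_abs_sub_le_and_den_le t (n := N) (by omega)
  obtain ⟨q, hqr⟩ : ∃ q, q = r.den := ⟨_, rfl⟩
  have hq1 : 1 ≤ q := hqr ▸ r.pos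
  have : NeZero q := ⟨by omega⟩
  have ha : IsCoprime r.num q := by
    rw [hqr, Int.isCoprime_iff_gcd_eq_one]
    exact r.reduced
  obtain ⟨β, hβt⟩ : ∃ β, β = t - r := ⟨_, rfl⟩
  have ht : t = (r.num : ℝ) / q + β := by
    rw [hβt, hqr, ← Rat.cast_def r]
    ring
  have hN0 : (0 : ℝ) < N := by exact_mod_cast hN
  have hq0 : (0 : ℝ) < q := by exact_mod_cast hq1
  have hβ : |β| ≤ 1 / (q * N) := by
    rw [hβt]
    refine hr.trans ?_
    rw [hqr] at hq0 ⊢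
    rw [mul_comm (r.den : ℝ)]
    gcongr
    linarith
  have hQ1 : 2 ^ Nat.log 2 q ≤ q := Nat.pow_log_le_self 2 (by omega)
  have hQ2 : q < 2 * 2 ^ Nat.log 2 q := by
    have := Nat.lt_pow_succ_log_self (b := 2) (by norm_num) q
    rwa [pow_succ, mul_comm] at this
  have hQN : 2 ^ Nat.log 2 q ≤ N := hQ1.trans (hqr ▸ hrN)
  obtain ⟨l, hl, hβl, hcase⟩ := exists_dyadic_scale Nat.one_le_two_pow hQN hQ1 hQ2 hβ
  refine ⟨Nat.log 2 q, l, hQN, hl, ?_⟩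
  set L : ℝ := 2 ^ l with hL
  have hL1 : 1 ≤ L := one_le_pow₀ (by norm_num)
  have hLq : L * q ≤ 2 * N := by
    rw [le_div_iff₀ (by positivity)] at hl
    have : (q : ℝ) ≤ 2 * (2 ^ Nat.log 2 q : ℕ) := by exact_mod_cast hQ2.le
    nlinarith
  set A : ℂ := (q : ℂ) ^ 2 * (1 / (N : ℂ) ^ 2 - 2 * Complex.I * β) with hA
  have hAeq : A = (((q : ℝ) ^ 2 / N ^ 2 : ℝ) : ℂ) + ((-2 * q ^ 2 * β : ℝ) : ℂ) * Complex.I := by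
    rw [hA]
    push_cast
    ring
  have hre : A.re = (q : ℝ) ^ 2 / N ^ 2 := by
    rw [hAeq, Complex.add_re, Complex.re_ofReal_mul, Complex.ofReal_re, Complex.I_re]
    ring
  have him : A.im = -2 * q ^ 2 * β := by
    rw [hAeq, Complex.add_im, Complex.im_ofReal_mul, Complex.ofReal_im, Complex.I_im]
    ring
  have hA0 : 0 < A.re := by
    rw [hre]
    positivity
  have hnA : 0 < ‖A‖ := hA0.trans_le (Complex.re_le_norm A)
  -- The dual Gaussians have width `O(2^{-l})`: `Re(1/A) = Re A/|A|²`, with `L|β|qN ≤ 1` and `Lq ≤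
  -- 2N`.
  have hs : L ^ 2 / 8 ≤ (1 / A).re := by
    rw [one_div, Complex.inv_re, Complex.normSq_apply, hre, him, div_le_div_iff₀ (by norm_num)
      (add_pos_of_pos_of_nonneg (by positivity) (mul_self_nonneg _))]
    have hb : (L * (|β| * q * N)) ^ 2 ≤ 1 := by
      rw [le_div_iff₀ (by positivity)] at hβl
      apply pow_le_one₀ (by positivity)
      linarith
    have hb' : (L * q) ^ 2 ≤ (2 * N) ^ 2 := by gcongr
    have e1 : L ^ 2 * ((q : ℝ) ^ 2 / N ^ 2 * (q ^ 2 / N ^ 2) + -2 * q ^ 2 * β * (-2 * q ^ 2 * β)) =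
        q ^ 2 / N ^ 2 * ((L * q) ^ 2 / N ^ 2 + 4 * (L * (|β| * q * N)) ^ 2) := by
      rw [show (L * (|β| * q * N)) ^ 2 = L ^ 2 * (|β| ^ 2 * q ^ 2 * N ^ 2) by ring, sq_abs]
      field_simp
      ring
    rw [e1]
    have : (L * q) ^ 2 / (N : ℝ) ^ 2 ≤ 4 := by
      rw [div_le_iff₀ (by positivity)]
      linarith
    gcongr
    linarith
  have hs0 : 0 < (1 / A).re := lt_of_lt_of_le (by positivity) hs
  -- By maximality of `l`, either `Re A` or `|Im A|` is at least `q/(2LN)`.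
  have hfrac : √(2 * q / ‖A‖) ≤ 2 * √(L * N) := by
    rw [show (2 : ℝ) * √(L * N) = √(2 ^ 2 * (L * N)) by
      rw [Real.sqrt_mul (sq_nonneg _), Real.sqrt_sq zero_le_two]]
    apply Real.sqrt_le_sqrt
    rw [div_le_iff₀ hnA]
    rcases hcase with h | h
    · have h1 : (q : ℝ) ^ 2 / N ^ 2 ≤ ‖A‖ := hre ▸ Complex.re_le_norm A
      calc (2 : ℝ) * q = 2 * N * N * (q ^ 2 / N ^ 2) / q := by field_simp
        _ ≤ 2 * N * (2 * L * q) * (q ^ 2 / N ^ 2) / q := by gcongr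
        _ = 4 * (L * N) * (q ^ 2 / N ^ 2) := by field_simp; ring
        _ ≤ 2 ^ 2 * (L * N) * ‖A‖ := by norm_num; gcongr
    · have h1 : 2 * (q : ℝ) ^ 2 * |β| ≤ ‖A‖ := by
        have := Complex.abs_im_le_norm A
        rwa [him, abs_mul, abs_mul, abs_neg, abs_two, abs_of_pos (by positivity : (0 : ℝ) < q ^ 2)] at this
      calc (2 : ℝ) * q ≤ 2 * q * (2 * L * |β| * q * N) := by nlinarith
        _ = 2 * (L * N) * (2 * q ^ 2 * |β|) := by ring
        _ ≤ 2 ^ 2 * (L * N) * ‖A‖ := by gcongr; norm_num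
  have hmain := norm_gaussianKernel_le hN r.num ha x β A hA hA0
  rw [← ht] at hmain
  have hsum : ∑' k : ℤ, Real.exp (-Real.pi * ((k : ℝ) - q * x) ^ 2 * (1 / A).re) ≤
      C₀ * ((periodize (S N ε (2 ^ Nat.log 2 q) l)).indicator (fun _ => (1 : ℝ)) (x, t) +
          Real.exp (-Real.pi * ((N : ℝ) ^ ε) ^ 2 / 16)) := by
    by_cases hmem : (x, t) ∈ periodize (S N ε (2 ^ Nat.log 2 q) l)
    · rw [indicator_of_mem hmem]
      refine (hC _ (by nlinarith) _).trans ?_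
      have := Real.exp_pos (-Real.pi * ((N : ℝ) ^ ε) ^ 2 / 16)
      nlinarith
    · rw [indicator_of_notMem hmem, zero_add]
      have hfar : ∀ k : ℤ, (N : ℝ) ^ ε / L ≤ |(k : ℝ) - q * x| := by
        intro k
        by_contra! h
        exact hmem (ht ▸ mem_periodize_S hQ1 hQ2 ha hβl h.le)
      -- Half of the exponent pays for the decay `exp(-π N^{2ε}/16)`; the other half keeps the sum
      -- over `k` bounded.
      calc _ ≤ ∑' k : ℤ, Real.exp (-Real.pi * ((k : ℝ) - q * x) ^ 2 * ((1 / A).re / 2)) *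
            Real.exp (-Real.pi * ((N : ℝ) ^ ε) ^ 2 / 16) := by
            refine Summable.tsum_le_tsum (fun k => ?_) (summable_gaussian hs0 _)
              ((summable_gaussian (by positivity) _).mul_right _)
            rw [← Real.exp_add, Real.exp_le_exp]
            have h1 : ((N : ℝ) ^ ε / L) ^ 2 * (L ^ 2 / 8) ≤
                ((k : ℝ) - q * x) ^ 2 * (1 / A).re := by
              rw [← sq_abs ((k : ℝ) - q * x)]
              have := hfar k
              gcongr
            rw [div_pow, div_mul_div_comm, mul_comm (L ^ 2) 8, mul_div_mul_right _ _
              (by positivity)] at h1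
            nlinarith [Real.pi_pos]
        _ ≤ _ := by
            rw [tsum_mul_right]
            gcongr
            exact hC _ (by nlinarith) _
  calc _ ≤ _ := hmain
    _ ≤ 2 * √(L * N) * _ := by
        refine mul_le_mul hfrac hsum (tsum_nonneg fun _ => (Real.exp_pos _).le) (by positivity)
    _ = _ := by ring

/-! ### Duality and `TT*` -/

/-- Take for `c r` the conjugate phase of the `r`-th sum (`0` if that sum vanishes), exchange the
sums and apply Cauchy–Schwarz. -/
lemma exists_dual_coefficients {ι : Type*} (s : Finset ι) {R : ℕ} (b : ι → ℂ)
    (hb : ∑ n ∈ s, ‖b n‖ ^ 2 ≤ 1) (φ : Fin R → ι → ℂ) {V : ℝ} (hV : 0 ≤ V)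
    (h : ∀ r, V ≤ ‖∑ n ∈ s, b n * φ r n‖) :
    ∃ c : Fin R → ℂ, (∀ r, ‖c r‖ ≤ 1) ∧ (R * V) ^ 2 ≤ ∑ n ∈ s, ‖∑ r, c r * φ r n‖ ^ 2 := by
  set f : Fin R → ℂ := fun r => ∑ n ∈ s, b n * φ r n with hf
  refine ⟨fun r => (starRingEnd ℂ) (f r) / ‖f r‖, fun r => ?_, ?_⟩
  · rw [norm_div, RCLike.norm_conj, Complex.norm_real, norm_norm]
    exact div_self_le_one _
  have h1 : ∀ r, (starRingEnd ℂ) (f r) / ‖f r‖ * f r = (‖f r‖ : ℂ) := by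
    intro r
    by_cases h0 : f r = 0
    · simp [h0]
    · have : (‖f r‖ : ℂ) ≠ 0 := by simpa using h0
      rw [div_mul_eq_mul_div, mul_comm, Complex.mul_conj', sq, mul_div_assoc, div_self this,
        mul_one]
  have h2 : (R : ℝ) * V ≤ ∑ n ∈ s, ‖b n‖ * ‖∑ r, (starRingEnd ℂ) (f r) / ‖f r‖ * φ r n‖ := by
    calc (R : ℝ) * V = ∑ _r : Fin R, V := by simp
      _ ≤ ∑ r, ‖f r‖ := Finset.sum_le_sum fun r _ => h r
      _ = ‖∑ r, (starRingEnd ℂ) (f r) / ‖f r‖ * f r‖ := by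
          simp_rw [h1]
          rw [← Complex.ofReal_sum, Complex.norm_real, Real.norm_of_nonneg
            (Finset.sum_nonneg fun _ _ => norm_nonneg _)]
      _ = ‖∑ n ∈ s, b n * ∑ r, (starRingEnd ℂ) (f r) / ‖f r‖ * φ r n‖ := by
          congr 1
          simp_rw [Finset.mul_sum]
          rw [Finset.sum_comm]
          refine Finset.sum_congr rfl fun r _ => ?_
          nth_rewrite 3 [hf]
          rw [Finset.mul_sum]
          exact Finset.sum_congr rfl fun n _ => by ring
      _ ≤ _ := (norm_sum_le _ _).trans (Finset.sum_le_sum fun n _ => (norm_mul _ _).le)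
  calc (R * V) ^ 2 ≤ _ := pow_le_pow_left₀ (by positivity) h2 2
    _ ≤ (∑ n ∈ s, ‖b n‖ ^ 2) * _ := Finset.sum_mul_sq_le_sq_mul_sq _ _ _
    _ ≤ _ := mul_le_of_le_one_left (Finset.sum_nonneg fun _ _ => sq_nonneg _) hb

/-- The Gaussian weight is at least `e^{-π}` on `[1, N]` and positive elsewhere, so the sum extends
to all of `ℤ`; expanding the square produces the kernel at differences. -/
lemma sum_norm_sq_le_gaussianKernel {N R : ℕ} (hN : 1 ≤ N) (c : Fin R → ℂ) (hc : ∀ r, ‖c r‖ ≤ 1)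
    (z : Fin R → ℝ × ℝ) :
    ∑ n ∈ Finset.Icc (1 : ℤ) N, ‖∑ r, c r * e (n * (z r).1 + (n : ℝ) ^ 2 * (z r).2)‖ ^ 2 ≤
      Real.exp Real.pi * ∑ r, ∑ s, ‖gaussianKernel N (z r - z s).1 (z r - z s).2‖ := by
  have hN0 : (0 : ℝ) < N := by exact_mod_cast hN
  set g : ℤ → ℂ := fun n => ∑ r, c r * e (n * (z r).1 + (n : ℝ) ^ 2 * (z r).2) with hg
  set ω : ℤ → ℝ := fun n => Real.exp (-Real.pi * (n : ℝ) ^ 2 * (1 / (N : ℝ) ^ 2)) with hω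
  set T : ℂ := ∑ r, ∑ s, c r * (starRingEnd ℂ) (c s) *
    gaussianKernel N (z r - z s).1 (z r - z s).2 with hT
  have hsum : HasSum (fun n : ℤ => ((ω n * ‖g n‖ ^ 2 : ℝ) : ℂ)) T := by
    have h1 : HasSum (fun n : ℤ => ∑ r, ∑ s, c r * (starRingEnd ℂ) (c s) * ((ω n : ℂ) *
        e (n * (z r - z s).1 + (n : ℝ) ^ 2 * (z r - z s).2))) T :=
      hasSum_sum fun r _ => hasSum_sum fun s _ =>
        (summable_gaussianKernel hN (z r - z s).1 (z r - z s).2).hasSum.mul_left _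
    convert h1 using 2 with n
    rw [Complex.ofReal_mul, Complex.ofReal_pow, ← Complex.mul_conj', hg, map_sum,
      Finset.sum_mul_sum, Finset.mul_sum]
    refine Finset.sum_congr rfl fun r _ => ?_
    rw [Finset.mul_sum]
    refine Finset.sum_congr rfl fun s _ => ?_
    rw [map_mul, conj_e, Prod.fst_sub, Prod.snd_sub,
      show (n : ℝ) * ((z r).1 - (z s).1) + (n : ℝ) ^ 2 * ((z r).2 - (z s).2) =
        (n * (z r).1 + (n : ℝ) ^ 2 * (z r).2) + -(n * (z s).1 + (n : ℝ) ^ 2 * (z s).2) by ring,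
      e_add (n * (z r).1 + (n : ℝ) ^ 2 * (z r).2)]
    ring
  have hre : HasSum (fun n : ℤ => ω n * ‖g n‖ ^ 2) T.re := by
    simpa only [Complex.ofReal_re] using Complex.hasSum_re hsum
  have hle : T.re ≤ ∑ r, ∑ s, ‖gaussianKernel N (z r - z s).1 (z r - z s).2‖ := by
    refine (Complex.re_le_norm _).trans ((norm_sum_le _ _).trans (Finset.sum_le_sum fun r _ =>
      (norm_sum_le _ _).trans (Finset.sum_le_sum fun s _ => ?_)))
    rw [norm_mul, norm_mul, RCLike.norm_conj]
    exact mul_le_of_le_one_left (norm_nonneg _)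
      (mul_le_one₀ (hc r) (norm_nonneg _) (hc s))
  calc ∑ n ∈ Finset.Icc (1 : ℤ) N, ‖g n‖ ^ 2
      ≤ ∑ n ∈ Finset.Icc (1 : ℤ) N, Real.exp Real.pi * (ω n * ‖g n‖ ^ 2) := by
        refine Finset.sum_le_sum fun n hn => ?_
        rw [Finset.mem_Icc] at hn
        rw [← mul_assoc, ← Real.exp_add]
        refine le_mul_of_one_le_left (sq_nonneg _) (Real.one_le_exp ?_)
        have h1 : (1 : ℝ) ≤ n := by exact_mod_cast hn.1
        have h2 : (n : ℝ) ≤ N := by exact_mod_cast hn.2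
        have h3 : (n : ℝ) ^ 2 * (1 / (N : ℝ) ^ 2) ≤ 1 := by
          rw [mul_one_div, div_le_one (by positivity)]
          gcongr
        nlinarith [Real.pi_pos]
    _ = Real.exp Real.pi * ∑ n ∈ Finset.Icc (1 : ℤ) N, ω n * ‖g n‖ ^ 2 := by
        rw [Finset.mul_sum]
    _ ≤ _ := by
        gcongr
        exact (sum_le_hasSum _ (fun n _ => by positivity) hre).trans hle

/-- The `TT*` inequality for large values of Weyl sums. -/
lemma large_values_le_gaussianKernel {N R : ℕ} (hN : 1 ≤ N) {a : ℤ → ℂ} (ha : L2Normalized a)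
    (z : Fin R → ℝ × ℝ) {V : ℝ} (hV : 0 ≤ V)
    (h : ∀ r, V ≤ ‖schrodingerSum N a (z r).1 (z r).2‖) :
    (R * V) ^ 2 ≤ Real.exp Real.pi *
      ∑ r, ∑ s, ‖gaussianKernel N (z r - z s).1 (z r - z s).2‖ := by
  obtain ⟨c, hc, hle⟩ := exists_dual_coefficients (Finset.Icc (1 : ℤ) N) a
    (sum_le_hasSum _ (fun _ _ => sq_nonneg _) ha)
    (fun r n => e (n * (z r).1 + (n : ℝ) ^ 2 * (z r).2)) hV h
  exact hle.trans (sum_norm_sq_le_gaussianKernel hN c hc z)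

/-! ### Pigeonholing the scales and absorbing losses -/

lemma pairCount_nonneg (N : ℕ) (ε : ℝ) (Q l : ℕ) {R : ℕ} (z : Fin R → ℝ × ℝ) :
    0 ≤ pairCount N ε Q l z :=
  Finset.sum_nonneg fun _ _ => Finset.sum_nonneg fun _ _ => indicator_nonneg (fun _ _ => zero_le_one) _

/-- The scale in the kernel bound varies with the pair `(r, s)`. Summing over all admissible scales
and keeping the largest contribution gives one common scale at the cost of `(log₂ N + 1)²`. -/
lemma exists_sum_gaussianKernel_le : ∃ C : ℝ, 0 < C ∧ ∀ N : ℕ, 1 ≤ N → ∀ ε : ℝ,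
    ∀ (R : ℕ) (z : Fin R → ℝ × ℝ), ∃ k l : ℕ, 2 ^ k ≤ N ∧ (2 : ℝ) ^ l ≤ (N : ℝ) / (2 ^ k : ℕ) ∧
      ∑ r, ∑ s, ‖gaussianKernel N (z r - z s).1 (z r - z s).2‖ ≤
        C * (((Nat.log 2 N : ℝ) + 1) ^ 2 * (√(2 ^ l * N) * pairCount N ε (2 ^ k) l z) +
          R ^ 2 * (N * Real.exp (-Real.pi * ((N : ℝ) ^ ε) ^ 2 / 16))) := by
  obtain ⟨C, hC, hK⟩ := exists_norm_gaussianKernel_le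
  refine ⟨C, hC, fun N hN ε R z => ?_⟩
  have hN0 : (0 : ℝ) < N := by exact_mod_cast hN
  set E := Real.exp (-Real.pi * ((N : ℝ) ^ ε) ^ 2 / 16) with hE
  have hE0 : 0 < E := Real.exp_pos _
  have hlN : ∀ k l : ℕ, (2 : ℝ) ^ l ≤ (N : ℝ) / (2 ^ k : ℕ) → (2 : ℝ) ^ l ≤ N := fun k l h =>
    h.trans (div_le_self hN0.le (by exact_mod_cast Nat.one_le_two_pow))
  set P : Finset (ℕ × ℕ) := (Finset.range (Nat.log 2 N + 1) ×ˢ Finset.range (Nat.log 2 N + 1)).filter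
    fun p => 2 ^ p.1 ≤ N ∧ (2 : ℝ) ^ p.2 ≤ (N : ℝ) / (2 ^ p.1 : ℕ) with hP
  have hmemP : ∀ k l : ℕ, 2 ^ k ≤ N → (2 : ℝ) ^ l ≤ (N : ℝ) / (2 ^ k : ℕ) → (k, l) ∈ P := by
    intro k l hk hl
    have hl' : 2 ^ l ≤ N := by exact_mod_cast hlN k l hl
    simp only [hP, Finset.mem_filter, Finset.mem_product, Finset.mem_range, Nat.lt_succ_iff]
    exact ⟨⟨Nat.le_log_of_pow_le one_lt_two hk, Nat.le_log_of_pow_le one_lt_two hl'⟩, hk, hl⟩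
  have hPne : P.Nonempty := ⟨(0, 0), hmemP 0 0 (by simpa using hN) (by simpa using hN)⟩
  have hPcard : (P.card : ℝ) ≤ ((Nat.log 2 N : ℝ) + 1) ^ 2 := by
    have : P.card ≤ (Nat.log 2 N + 1) ^ 2 := by
      refine (Finset.card_filter_le _ _).trans_eq ?_
      rw [Finset.card_product, Finset.card_range, ← sq]
    exact_mod_cast this
  set G : ℕ × ℕ → ℝ := fun p => √(2 ^ p.2 * N) * pairCount N ε (2 ^ p.1) p.2 z with hG
  obtain ⟨⟨k, l⟩, hp, hmax⟩ := P.exists_max_image G hPne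
  have hp' := (Finset.mem_filter.mp hp).2
  refine ⟨k, l, hp'.1, hp'.2, ?_⟩
  have hpt : ∀ r s, ‖gaussianKernel N (z r - z s).1 (z r - z s).2‖ ≤
      C * (∑ p ∈ P, √(2 ^ p.2 * N) *
        (periodize (S N ε (2 ^ p.1) p.2)).indicator (fun _ => (1 : ℝ)) (z r - z s) + N * E) := by
    intro r s
    obtain ⟨k', l', hk', hl', hle⟩ := hK N hN ε (z r - z s).1 (z r - z s).2
    refine hle.trans ?_
    rw [mul_assoc, mul_add]
    have h1 := Finset.single_le_sum (f := fun p : ℕ × ℕ => √(2 ^ p.2 * N) *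
        (periodize (S N ε (2 ^ p.1) p.2)).indicator (fun _ => (1 : ℝ)) (z r - z s))
      (fun p _ => mul_nonneg (Real.sqrt_nonneg _) (indicator_nonneg (fun _ _ => zero_le_one) _))
      (hmemP k' l' hk' hl')
    have h2 : √(2 ^ l' * N) ≤ N := by
      rw [Real.sqrt_le_left hN0.le, sq]
      gcongr
      exact hlN _ _ hl'
    gcongr
  calc _ ≤ ∑ r : Fin R, ∑ s : Fin R, C * (∑ p ∈ P, √(2 ^ p.2 * N) *
        (periodize (S N ε (2 ^ p.1) p.2)).indicator (fun _ => (1 : ℝ)) (z r - z s) + N * E) :=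
        Finset.sum_le_sum fun r _ => Finset.sum_le_sum fun s _ => hpt r s
    _ = C * (∑ p ∈ P, G p + R ^ 2 * (N * E)) := by
        simp_rw [← Finset.mul_sum, Finset.sum_add_distrib]
        congr 2
        · simp_rw [hG, pairCount, Finset.mul_sum]
          exact (Finset.sum_congr rfl fun r _ => Finset.sum_comm).trans Finset.sum_comm
        · simp
          ring
    _ ≤ _ := by
        gcongr
        calc ∑ p ∈ P, G p ≤ P.card • G (k, l) := Finset.sum_le_card_nsmul _ _ _ hmax
          _ ≤ _ := by
            rw [nsmul_eq_mul]
            gcongr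
            exact mul_nonneg (Real.sqrt_nonneg _) (pairCount_nonneg _ _ _ _ _)

lemma exists_natLog_sq_le {ε : ℝ} (hε : 0 < ε) : ∃ C : ℝ, 0 < C ∧ ∀ N : ℕ, 1 ≤ N →
    ((Nat.log 2 N : ℝ) + 1) ^ 2 ≤ C * (N : ℝ) ^ ε := by
  have hl2 : 0 < Real.log 2 := Real.log_pos one_lt_two
  refine ⟨(1 / (ε / 2) / Real.log 2 + 1) ^ 2, by positivity, fun N hN => ?_⟩
  have hN1 : (1 : ℝ) ≤ N := by exact_mod_cast hN
  have h1 : (Nat.log 2 N : ℝ) ≤ (N : ℝ) ^ (ε / 2) / (ε / 2) / Real.log 2 := by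
    refine (Real.natLog_le_logb N 2).trans ?_
    rw [Real.logb, Nat.cast_ofNat]
    gcongr
    exact Real.log_le_rpow_div (by linarith) (by linarith)
  have h2 : 1 ≤ (N : ℝ) ^ (ε / 2) := Real.one_le_rpow hN1 (by linarith)
  have h3 : (N : ℝ) ^ ε = ((N : ℝ) ^ (ε / 2)) ^ 2 := by
    rw [← Real.rpow_natCast, ← Real.rpow_mul (by linarith)]
    congr 1
    push_cast
    ring
  rw [h3, ← mul_pow]
  gcongr
  calc (Nat.log 2 N : ℝ) + 1 ≤ (N : ℝ) ^ (ε / 2) / (ε / 2) / Real.log 2 + (N : ℝ) ^ (ε / 2) := by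
        gcongr
    _ = _ := by ring

lemma eventually_mul_exp_neg_rpow_le {ε : ℝ} (hε : 0 < ε) {η : ℝ} (hη : 0 < η) :
    ∃ N₀ : ℕ, ∀ N : ℕ, N₀ ≤ N →
      N * Real.exp (-Real.pi * ((N : ℝ) ^ ε) ^ 2 / 16) ≤ η * √N := by
  -- The exponent is chosen so that `(N^{2ε})^{-1/(4ε)} = N^{-1/2}`.
  have h1 := isLittleO_exp_neg_mul_rpow_atTop (a := Real.pi / 16) (by positivity) (-1 / (4 * ε))
  have h2 : Filter.Tendsto (fun N : ℕ => (N : ℝ) ^ (2 * ε)) Filter.atTop Filter.atTop :=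
    (tendsto_rpow_atTop (by positivity)).comp tendsto_natCast_atTop_atTop
  have h3 := ((h1.comp_tendsto h2).def hη).and (Filter.eventually_ge_atTop 1)
  obtain ⟨N₀, h⟩ := Filter.eventually_atTop.mp h3
  refine ⟨N₀, fun N hN => ?_⟩
  obtain ⟨h4, h5⟩ := h N hN
  have hN0 : (0 : ℝ) < N := by exact_mod_cast h5
  simp only [Function.comp, Real.norm_eq_abs, Real.abs_exp] at h4
  rw [abs_of_nonneg (by positivity), ← Real.rpow_mul hN0.le,
    show 2 * ε * (-1 / (4 * ε)) = -(1 / 2) by field_simp; ring, Real.rpow_neg hN0.le,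
    ← Real.sqrt_eq_rpow] at h4
  have h6 : ((N : ℝ) ^ ε) ^ 2 = (N : ℝ) ^ (2 * ε) := by
    rw [← Real.rpow_natCast, ← Real.rpow_mul hN0.le, mul_comm]
    norm_num
  rw [h6, show -Real.pi * (N : ℝ) ^ (2 * ε) / 16 = -(Real.pi / 16) * (N : ℝ) ^ (2 * ε) by ring]
  calc _ ≤ (N : ℝ) * (η * (√N)⁻¹) := by gcongr
    _ = η * √N := by
      have := Real.mul_self_sqrt hN0.le
      have h7 : 0 < √(N : ℝ) := Real.sqrt_pos.mpr hN0
      field_simp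
      nlinarith

/-! ### Separated points, times and weights -/

/-- A separated family that cannot be enlarged exists because cardinalities are bounded, and its
`d`-balls cover `E`. -/
lemma volume_le_of_separated_card_le {E : Set ℝ} {d B : ℝ} (hd : 0 < d)
    (h : ∀ (R : ℕ) (x : Fin R → ℝ), (∀ r, x r ∈ E) → (∀ r s, r ≠ s → d ≤ |x r - x s|) →
      (R : ℝ) ≤ B) :
    volume E ≤ ENNReal.ofReal (2 * d * B) := by
  obtain ⟨R, ⟨x, hxE, hx⟩, hmax⟩ : ∃ R : ℕ,
      (∃ x : Fin R → ℝ, (∀ r, x r ∈ E) ∧ ∀ r s, r ≠ s → d ≤ |x r - x s|) ∧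
      ¬ ∃ x : Fin (R + 1) → ℝ, (∀ r, x r ∈ E) ∧ ∀ r s, r ≠ s → d ≤ |x r - x s| := by
    by_contra! hcon
    have hall : ∀ R : ℕ, ∃ x : Fin R → ℝ, (∀ r, x r ∈ E) ∧ ∀ r s, r ≠ s → d ≤ |x r - x s| := by
      intro R
      induction R with
      | zero => exact ⟨Fin.elim0, fun r => r.elim0, fun r => r.elim0⟩
      | succ R ih => exact hcon R ih
    obtain ⟨n, hn⟩ := exists_nat_gt B
    obtain ⟨x, hxE, hx⟩ := hall n
    exact absurd (h n x hxE hx) (not_le.mpr hn)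
  have hcover : E ⊆ ⋃ r, Metric.ball (x r) d := by
    intro y hy
    by_contra hnot
    simp only [mem_iUnion, Metric.mem_ball, not_exists, not_lt, Real.dist_eq] at hnot
    refine hmax ⟨Fin.cons y x, fun r => ?_, fun r s hrs => ?_⟩
    · cases r using Fin.cases with
      | zero => exact hy
      | succ r => exact hxE r
    · cases r using Fin.cases with
      | zero =>
        cases s using Fin.cases with
        | zero => exact absurd rfl hrs
        | succ s => exact hnot s
      | succ r =>
        cases s using Fin.cases with
        | zero =>
          rw [abs_sub_comm]
          exact hnot r
        | succ s => exact hx r s fun h => hrs (congrArg _ h)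
  calc volume E ≤ volume (⋃ r, Metric.ball (x r) d) := measure_mono hcover
    _ ≤ ∑ r, volume (Metric.ball (x r) d) := measure_iUnion_fintype_le _ _
    _ = ENNReal.ofReal (2 * d * R) := by
        simp only [Real.volume_ball, Finset.sum_const, Finset.card_univ, Fintype.card_fin,
          nsmul_eq_mul]
        rw [ENNReal.ofReal_mul (p := 2 * d) (by positivity), ENNReal.ofReal_natCast, mul_comm]
    _ ≤ _ := by
        have := h R x hxE hx
        gcongr

/-- Halving `lam` avoids attainment of the supremum; periodicity in `t` brings the time into `[0,
1]`. -/
lemma exists_time_of_mem_levelSet {N : ℕ} {a : ℤ → ℂ} {lam x : ℝ} (hlam : 0 < lam)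
    (hx : x ∈ levelSet N a lam) : ∃ t ∈ Icc (0 : ℝ) 1, lam / 2 ≤ ‖schrodingerSum N a x t‖ := by
  obtain ⟨t, ht⟩ := exists_lt_of_lt_ciSup ((half_lt_self hlam).trans_le hx.2)
  refine ⟨Int.fract t, ⟨Int.fract_nonneg t, (Int.fract_lt_one t).le⟩, ht.le.trans (le_of_eq ?_)⟩
  congr 1
  refine Finset.sum_congr rfl fun n _ => ?_
  rw [← e_add_intCast (n * x + (n : ℝ) ^ 2 * Int.fract t) (n ^ 2 * ⌊t⌋)]
  congr 2
  rw [Int.fract]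
  push_cast
  ring

/-- The free height `A` absorbs constants: the conjecture fixes the threshold `M N^{1/4}` and the
normalisation of the coefficients, but not `w`. -/
lemma exists_plateau_schwartzMap (A : ℝ) : ∃ w : SchwartzMap ℝ ℝ,
    Function.support w ⊆ Icc (-2 : ℝ) 2 ∧ ∀ y ∈ Icc (0 : ℝ) 1, w y = A := by
  let f : ContDiffBump (0 : ℝ) := ⟨1, 2, one_pos, one_lt_two⟩
  have hcs : HasCompactSupport fun y => A * f y := f.hasCompactSupport.mul_left
  have hcd : ContDiff ℝ (⊤ : ℕ∞) fun y => A * f y := contDiff_const.mul f.contDiff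
  refine ⟨hcs.toSchwartzMap hcd, fun y hy => ?_, fun y hy => ?_⟩
  · have hy' : A * f y ≠ 0 := hy
    have h1 : y ∈ Function.support f := right_ne_zero_of_mul hy'
    rw [f.support_eq, Real.ball_eq_Ioo] at h1
    exact ⟨by simpa [f] using h1.1.le, by simpa [f] using h1.2.le⟩
  · have h1 : f y = 1 := f.one_of_mem_closedBall (by
      rw [Real.closedBall_eq_Icc]
      exact ⟨by simp [f]; linarith [hy.1], by simpa [f] using hy.2⟩)
    change A * f y = A
    rw [h1, mul_one]

/-- Truncating to `[1, N]` and renormalising does not decrease the size of the sum. -/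
lemma exists_weightedSum_ge {N : ℕ} (hN : 1 ≤ N) {a : ℤ → ℂ} (ha : L2Normalized a) {A : ℝ}
    (hA : 0 < A) (w : SchwartzMap ℝ ℝ) (hw : ∀ y ∈ Icc (0 : ℝ) 1, w y = A) {x₀ t₀ : ℝ}
    (h₀ : schrodingerSum N a x₀ t₀ ≠ 0) :
    ∃ b : ℤ → ℂ, L2Normalized b ∧
      ∀ x t, A * ‖schrodingerSum N a x t‖ ≤ ‖weightedSum w N b x t‖ := by
  have hN0 : (0 : ℝ) < N := by exact_mod_cast hN
  set I := Finset.Icc (1 : ℤ) N with hI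
  set m := √(∑ n ∈ I, ‖a n‖ ^ 2) with hm
  have hm2 : m ^ 2 = ∑ n ∈ I, ‖a n‖ ^ 2 :=
    Real.sq_sqrt (Finset.sum_nonneg fun _ _ => sq_nonneg _)
  have hm1 : m ≤ 1 :=
    Real.sqrt_le_one.mpr (sum_le_hasSum _ (fun _ _ => sq_nonneg _) ha)
  have hm0 : 0 < m := by
    refine (Real.sqrt_nonneg _).lt_of_ne' fun h => h₀ ?_
    change m = 0 at h
    rw [h, zero_pow two_ne_zero, eq_comm,
      Finset.sum_eq_zero_iff_of_nonneg fun _ _ => sq_nonneg _] at hm2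
    refine Finset.sum_eq_zero fun n hn => ?_
    rw [norm_eq_zero.mp (pow_eq_zero_iff two_ne_zero |>.mp (hm2 n hn)), zero_mul]
  refine ⟨fun n => if n ∈ I then a n / m else 0, ?_, fun x t => ?_⟩
  · have h1 : HasSum (fun n => ‖if n ∈ I then a n / (m : ℂ) else 0‖ ^ 2)
        (∑ n ∈ I, ‖if n ∈ I then a n / (m : ℂ) else 0‖ ^ 2) :=
      hasSum_sum_of_ne_finset_zero fun n hn => by simp [hn]
    suffices h2 : ∑ n ∈ I, ‖if n ∈ I then a n / (m : ℂ) else 0‖ ^ 2 = 1 by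
      rw [h2] at h1
      exact h1
    rw [Finset.sum_congr rfl fun n hn => by
      rw [if_pos hn, norm_div, Complex.norm_real, Real.norm_of_nonneg hm0.le, div_pow],
      ← Finset.sum_div, ← hm2, div_self (by positivity)]
  · have h1 : weightedSum w N (fun n => if n ∈ I then a n / m else 0) x t =
        ((A / m : ℝ) : ℂ) * schrodingerSum N a x t := by
      rw [weightedSum, tsum_eq_sum (s := I) fun n hn => by simp [hn], schrodingerSum,
        Finset.mul_sum]
      refine Finset.sum_congr rfl fun n hn => ?_
      have hn' := Finset.mem_Icc.mp hn
      have h2 : (0 : ℝ) ≤ n := by exact_mod_cast (by omega : 0 ≤ n)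
      have h3 : (n : ℝ) ≤ N := by exact_mod_cast hn'.2
      rw [if_pos hn, hw _ ⟨by positivity, (div_le_one hN0).mpr h3⟩]
      push_cast
      ring
    rw [h1, norm_mul, Complex.norm_real, Real.norm_of_nonneg (by positivity)]
    gcongr
    exact le_div_self hA.le hm0 hm1

/-! ### Applying the counting conjecture -/

/-- The counting conjecture bounds separated families in a level set, for `N` large. -/
lemma exists_separated_card_le (M : ℕ → ℝ) (hM : ∀ N : ℕ, 1 ≤ N → 1 ≤ M N)
    (hconj : CountingConjecture M) {c δ : ℝ} (hc : 0 < c) (hδ : 0 < δ) :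
    ∃ (B : ℝ) (N₀ : ℕ), 0 ≤ B ∧ ∀ N : ℕ, 1 ≤ N → N₀ ≤ N → ∀ lam : ℝ,
      c * (M N * (N : ℝ) ^ (1 / 4 : ℝ)) ≤ lam → ∀ a : ℤ → ℂ, L2Normalized a →
      ∀ (R : ℕ) (x : Fin R → ℝ), (∀ r, x r ∈ levelSet N a lam) →
        (∀ r s, r ≠ s → 1 / (N : ℝ) ≤ |x r - x s|) →
        (R : ℝ) ≤ B * (N : ℝ) ^ δ * ((N : ℝ) / M N ^ 4) := by
  -- Height `2/c` undoes the constant `c` and the halving of `lam`.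
  obtain ⟨w, hwsupp, hw⟩ := exists_plateau_schwartzMap (2 / c)
  obtain ⟨ε, hε, hconj⟩ := hconj w hwsupp δ hδ
  obtain ⟨C₁, hC₁, hkernel⟩ := exists_sum_gaussianKernel_le
  obtain ⟨C₂, hC₂, hlog⟩ := exists_natLog_sq_le hε
  set D := Real.exp Real.pi * C₁ with hD
  have hD0 : 0 < D := by positivity
  -- With this `η` and `M N ≥ 1`, the error is at most half of the left side `R² c² M² √N/4`.
  obtain ⟨N₀, hN₀⟩ := eventually_mul_exp_neg_rpow_le hε (η := c ^ 2 / (8 * D)) (by positivity)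
  obtain ⟨C', hC'⟩ := hconj (8 * D * C₂ / c ^ 2)
  refine ⟨|C'|, N₀, abs_nonneg _, fun N hN hNN₀ lam hlam a ha R x hx hsep => ?_⟩
  have hN0 : (0 : ℝ) < N := by exact_mod_cast hN
  have hMN := hM N hN
  have hM0 : 0 < M N := by linarith
  have hlam0 : 0 < lam := lt_of_lt_of_le (by positivity) hlam
  rcases Nat.eq_zero_or_pos R with rfl | hR
  · rw [Nat.cast_zero]
    positivity
  choose t ht htle using fun r => exists_time_of_mem_levelSet hlam0 (hx r)
  have hne : schrodingerSum N a (x ⟨0, hR⟩) (t ⟨0, hR⟩) ≠ 0 := by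
    intro h
    have := htle ⟨0, hR⟩
    rw [h, norm_zero] at this
    linarith
  obtain ⟨b, hb, hbge⟩ := exists_weightedSum_ge hN ha (by positivity) w hw hne
  set z : Fin R → ℝ × ℝ := fun r => (x r, t r) with hz
  obtain ⟨k, l, hk, hl, hKle⟩ := hkernel N hN ε R z
  have hTT := large_values_le_gaussianKernel hN ha z (by positivity) htle
  refine (hC' N hN (2 ^ k) l ⟨k, rfl⟩ hk hl b hb R z (fun r => ⟨(hx r).1, ht r⟩) hsep
    (fun r => ?_) ?_).trans (by gcongr; exact le_abs_self _)
  · refine le_trans ?_ (hbge _ _)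
    calc M N * (N : ℝ) ^ (1 / 4 : ℝ) = 2 / c * (c * (M N * (N : ℝ) ^ (1 / 4 : ℝ)) / 2) := by
          field_simp
      _ ≤ 2 / c * (lam / 2) := by gcongr
      _ ≤ _ := by
          gcongr
          exact htle r
  · set pc := pairCount N ε (2 ^ k) l z with hpc
    have hpc0 : 0 ≤ pc := pairCount_nonneg _ _ _ _ _
    have hsN : 0 < √(N : ℝ) := Real.sqrt_pos.mpr hN0
    have h4 : ((N : ℝ) ^ (1 / 4 : ℝ)) ^ 2 = √N := by
      rw [← Real.rpow_natCast, ← Real.rpow_mul hN0.le, Real.sqrt_eq_rpow]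
      norm_num
    have hl2 : (2 : ℝ) ^ ((l : ℝ) / 2) = √(2 ^ l) := by
      rw [Real.sqrt_eq_rpow, ← Real.rpow_natCast, ← Real.rpow_mul zero_le_two]
      ring_nf
    have h5 : (R : ℝ) ^ 2 * (c ^ 2 * M N ^ 2 * √N / 4) ≤
        D * (C₂ * (N : ℝ) ^ ε * (√(2 ^ l) * √N * pc) + R ^ 2 * (c ^ 2 / (8 * D) * √N)) := by
      calc (R : ℝ) ^ 2 * (c ^ 2 * M N ^ 2 * √N / 4)
          = (R * (c * (M N * (N : ℝ) ^ (1 / 4 : ℝ)) / 2)) ^ 2 := by rw [← h4]; ring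
        _ ≤ (R * (lam / 2)) ^ 2 := by gcongr
        _ ≤ _ := hTT
        _ ≤ Real.exp Real.pi * _ := mul_le_mul_of_nonneg_left hKle (Real.exp_pos _).le
        _ ≤ _ := by
          rw [← mul_assoc, ← hD, Real.sqrt_mul (by positivity)]
          exact mul_le_mul_of_nonneg_left (add_le_add
            (mul_le_mul_of_nonneg_right (hlog N hN) (by positivity))
            (mul_le_mul_of_nonneg_left (hN₀ N hNN₀) (sq_nonneg _))) hD0.le
    have h6 : D * (R ^ 2 * (c ^ 2 / (8 * D) * √N)) ≤ (R : ℝ) ^ 2 * (c ^ 2 * M N ^ 2 * √N / 8) := by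
      have : (1 : ℝ) ≤ M N ^ 2 := one_le_pow₀ hMN
      calc D * (R ^ 2 * (c ^ 2 / (8 * D) * √N)) = (R : ℝ) ^ 2 * (c ^ 2 * 1 * √N / 8) := by
            field_simp
        _ ≤ _ := by gcongr
    have h7 : (R : ℝ) ^ 2 * (c ^ 2 * M N ^ 2 * √N / 8) ≤
        D * (C₂ * (N : ℝ) ^ ε * (√(2 ^ l) * √N * pc)) := by
      rw [mul_add] at h5
      linarith
    rw [hl2, show 8 * D * C₂ / c ^ 2 * (N : ℝ) ^ ε * (√(2 ^ l) / M N ^ 2 * pc) =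
      D * (C₂ * (N : ℝ) ^ ε * (√(2 ^ l) * √N * pc)) / (c ^ 2 * M N ^ 2 * √N / 8) by
        field_simp]
    rwa [le_div_iff₀ (by positivity)]

end PeriodicSchrodinger

theorem mainTheorem4 (M : ℕ → ℝ)
    (hM : ∀ N : ℕ, 1 ≤ N → 1 ≤ M N ∧ M N ≤ (N : ℝ) ^ (1 / 4 : ℝ))
    (hconj : PeriodicSchrodinger.CountingConjecture M) :
    ∀ c₁ c₂ : ℝ, 0 < c₁ → 0 < c₂ → ∀ ε : ℝ, 0 < ε → ∃ K : ℝ,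
      ∀ N : ℕ, 1 ≤ N → ∀ lam : ℝ,
        c₁ * (M N * (N : ℝ) ^ (1 / 4 : ℝ)) ≤ lam → lam ≤ c₂ * (M N * (N : ℝ) ^ (1 / 4 : ℝ)) →
        ∀ a : ℤ → ℂ, PeriodicSchrodinger.L2Normalized a →
          MeasureTheory.volume (PeriodicSchrodinger.levelSet N a lam) ≤
            ENNReal.ofReal (K * (N : ℝ) ^ ε * ((N : ℝ) / lam ^ 4)) := by
  intro c₁ c₂ hc₁ hc₂ ε hε
  obtain ⟨B, N₀, hB, hcard⟩ := PeriodicSchrodinger.exists_separated_card_le M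
    (fun N hN => (hM N hN).1) hconj hc₁ hε
  -- `2B` serves `N ≥ N₀`. For `N < N₀` the measure is at most `1 ≤ N/M^4 ≤ N₀/M^4`, by `M ≤
  -- N^{1/4}`.
  refine ⟨c₂ ^ 4 * (2 * B + N₀), fun N hN lam hlam₁ hlam₂ a ha => ?_⟩
  obtain ⟨hM1, hM2⟩ := hM N hN
  have hM0 : 0 < M N := by linarith
  have hN1 : (1 : ℝ) ≤ N := by exact_mod_cast hN
  have hN0 : (0 : ℝ) < N := by linarith
  have hNε : 1 ≤ (N : ℝ) ^ ε := Real.one_le_rpow hN1 hε.le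
  have hlam0 : 0 < lam := lt_of_lt_of_le (by positivity) hlam₁
  have hroot : ((N : ℝ) ^ (1 / 4 : ℝ)) ^ 4 = N := by
    rw [← Real.rpow_natCast, ← Real.rpow_mul hN0.le]
    norm_num
  have hlam4 : lam ^ 4 ≤ c₂ ^ 4 * M N ^ 4 * N := by
    calc lam ^ 4 ≤ (c₂ * (M N * (N : ℝ) ^ (1 / 4 : ℝ))) ^ 4 := by gcongr
      _ = c₂ ^ 4 * M N ^ 4 * ((N : ℝ) ^ (1 / 4 : ℝ)) ^ 4 := by ring
      _ = _ := by rw [hroot]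
  have hratio : 1 / M N ^ 4 ≤ c₂ ^ 4 * (N / lam ^ 4) := by
    rw [← mul_div_assoc, div_le_div_iff₀ (by positivity) (by positivity)]
    linarith
  rcases le_or_gt N₀ N with h | h
  · refine (PeriodicSchrodinger.volume_le_of_separated_card_le (by positivity)
      (hcard N hN h lam hlam₁ a ha)).trans (ENNReal.ofReal_le_ofReal ?_)
    calc 2 * (1 / (N : ℝ)) * (B * (N : ℝ) ^ ε * (N / M N ^ 4))
        = 2 * B * (N : ℝ) ^ ε * (1 / M N ^ 4) := by field_simp
      _ ≤ (2 * B + N₀) * (N : ℝ) ^ ε * (c₂ ^ 4 * (N / lam ^ 4)) := by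
          gcongr
          linarith [(Nat.cast_nonneg N₀ : (0 : ℝ) ≤ N₀)]
      _ = _ := by ring
  · have hsub : PeriodicSchrodinger.levelSet N a lam ⊆ Icc 0 1 := fun x hx => hx.1
    refine (measure_mono hsub).trans ?_
    rw [Real.volume_Icc]
    refine ENNReal.ofReal_le_ofReal ?_
    have hM4 : M N ^ 4 ≤ N := (pow_le_pow_left₀ hM0.le hM2 4).trans hroot.le
    have hNN₀ : (N : ℝ) ≤ N₀ := by exact_mod_cast h.le
    calc (1 : ℝ) - 0 = N * 1 * (1 / N) := by field_simp; ring
      _ ≤ (2 * B + N₀) * (N : ℝ) ^ ε * (1 / M N ^ 4) := by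
          gcongr
          linarith
      _ ≤ (2 * B + N₀) * (N : ℝ) ^ ε * (c₂ ^ 4 * (N / lam ^ 4)) := by gcongr
      _ = _ := by ring
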